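/- Let $d\ge 1$ and let $f:\mathbb R\to\mathbb R$ be continuous with $f(\eta)\ge 0$ for $\eta\ge 0$ and $$\liminf_{\eta\to\infty} f(\eta)\,e^{-\lambda\eta^p}>0$$ for some $\lambda>0$ and $p>1$. Let $\exp L^p(\mathbb R^d)$ be the Orlicz space of all $v\in L^1_{loc}(\mathbb R^d)$ with $\int_{\mathbb R^d}(e^{|v|^p/k^p}-1)\,dx<\infty$ for some $k>0$, with its Luxemburg norm $\inf\{k>0:\int_{\mathbb R^d}(e^{|v|^p/k^p}-1)\,dx\le 1\}$. It is the dual, via $\int vg\,dx$, of the Orlicz space of the complementary Young function $s\mapsto\sup_{r\ge0}(sr-e^{r^p}+1)$, which defines its weak$^\star$ topology. For $T>0$ and $u_0\in\exp L^p(\mathbb R^d)$, an $\exp L^p$-classical solution on $[0,T)$ of $$\partial_t u+(-\Delta+|x|^2)u=f(u),\qquad u(0)=u_0, \qquad (\ast)$$ is a function $u\in C((0,T];\exp L^p(\mathbb R^d))\cap L^\infty_{loc}(0,T;L^\infty(\mathbb R^d))\cap C^{1,2}((0,T)\times\mathbb R^d)$ that satisfies the equation pointwise on $(0,T)\times\mathbb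 R^d$ and $u(t)\to u_0$ in the weak$^\star$ topology of $\exp L^p(\mathbb R^d)$ as $t\to0^+$. Then there is a nonnegative $u_0\in\exp L^p(\mathbb R^d)$ such that, for every $T>0$, the problem $(\ast)$ has no nonnegative $\exp L^p$-classical solution on $[0,T)$. More precisely, there is $\alpha_0>0$ such that for every $\alpha>\alpha_0$ the function $$u_0(x)=\alpha(-\log|x|)^{1/p}\ \text{ if } |x|<1,\qquad u_0(x)=0\ \text{ if } |x|\ge1,$$ is nonnegative, belongs to $\exp L^p(\mathbb R^d)$ and has this property. -/

import Mathlib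

open MeasureTheory Set Filter Topology
open scoped ENNReal NNReal

noncomputable section

/-- `u` belongs to the Orlicz space `L^Φ(ℝ^d)`: it is locally integrable and
`∫ Φ(|u| / k) dx < ∞` for some `k > 0`. -/
def MemOrlicz {d : ℕ} (Φ : ℝ → ℝ≥0∞) (u : EuclideanSpace ℝ (Fin d) → ℝ) : Prop :=
  LocallyIntegrable u volume ∧ ∃ k : ℝ, 0 < k ∧ ∫⁻ x, Φ (|u x| / k) < ∞

/-- The Luxemburg norm `inf {k > 0 : ∫ Φ(|u| / k) dx ≤ 1}`, with the value `∞` if there is no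
such `k`. -/
def luxemburgNorm {d : ℕ} (Φ : ℝ → ℝ≥0∞) (u : EuclideanSpace ℝ (Fin d) → ℝ) : ℝ≥0∞ :=
  sInf (ENNReal.ofReal '' {k : ℝ | 0 < k ∧ ∫⁻ x, Φ (|u x| / k) ≤ 1})

/-- The Young function `s ↦ exp (s ^ p) - 1` (for `s ≥ 0`), whose Orlicz space is `exp L^p`. -/
def expYoung (p : ℝ) (s : ℝ) : ℝ≥0∞ :=
  ENNReal.ofReal (Real.exp (s ^ p) - 1)

/-- The complementary (Legendre conjugate) Young function `s ↦ sup_{r ≥ 0} (s r - Φ(r))`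
(for `s ≥ 0`). The subtraction is truncated at `0`, which does not change the supremum when
`Φ 0 = 0`, since `r = 0` then contributes the value `0`. -/
def youngConj (Φ : ℝ → ℝ≥0∞) (s : ℝ) : ℝ≥0∞ :=
  ⨆ r : ℝ≥0, (ENNReal.ofReal (s * r) - Φ r)

/-- `u ∈ exp L^p(ℝ^d)`. -/
def MemExpL {d : ℕ} (p : ℝ) (u : EuclideanSpace ℝ (Fin d) → ℝ) : Prop :=
  MemOrlicz (expYoung p) u

/-- `u(t) → u₀` as `t → 0⁺` in the weak-star topology of `exp L^p(ℝ^d)`, `p > 1`. This space is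
the dual of the Orlicz space of the complementary Young function (an `L (log L)^{1/p}` type
space), through the pairing `∫ u g dx`. -/
def TendstoWeakStar {d : ℕ} (p : ℝ) (u : ℝ → EuclideanSpace ℝ (Fin d) → ℝ)
    (u₀ : EuclideanSpace ℝ (Fin d) → ℝ) : Prop :=
  ∀ g : EuclideanSpace ℝ (Fin d) → ℝ, MemOrlicz (youngConj (expYoung p)) g →
    Tendsto (fun t => ∫ x, u t x * g x) (𝓝[>] 0) (𝓝 (∫ x, u₀ x * g x))

/-- `u ∈ C^{1,2}((0,T) × ℝ^d)`: the derivative in time and the derivatives in space up to order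
two exist and are jointly continuous on `(0,T) × ℝ^d`. The case `k = 0` is the joint
continuity of `u` itself. -/
structure IsC12 {d : ℕ} (T : ℝ) (u : ℝ → EuclideanSpace ℝ (Fin d) → ℝ) : Prop where
  differentiableAt_time : ∀ t ∈ Ioo 0 T, ∀ x, DifferentiableAt ℝ (fun s => u s x) t
  continuousOn_time : ContinuousOn
    (fun z : ℝ × EuclideanSpace ℝ (Fin d) => deriv (fun s => u s z.2) z.1) (Ioo 0 T ×ˢ univ)
  contDiff_space : ∀ t ∈ Ioo 0 T, ContDiff ℝ 2 (u t)
  continuousOn_space : ∀ k : ℕ, k ≤ 2 → ContinuousOn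
    (fun z : ℝ × EuclideanSpace ℝ (Fin d) => iteratedFDeriv ℝ k (u z.1) z.2) (Ioo 0 T ×ˢ univ)

/-- `u` is an `exp L^p`-classical solution on `[0,T)` of
`∂ₜu + (-Δ + |x|²)u = f(u)`, `u(0) = u₀`. -/
structure IsExpLClassicalSolution {d : ℕ} (f : ℝ → ℝ) (p T : ℝ)
    (u₀ : EuclideanSpace ℝ (Fin d) → ℝ) (u : ℝ → EuclideanSpace ℝ (Fin d) → ℝ) : Prop where
  /-- `u(t) ∈ exp L^p` for `t ∈ (0,T]` -/
  memExpL : ∀ t ∈ Ioc 0 T, MemExpL p (u t)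
  /-- `u : (0,T] → exp L^p` is continuous in the Luxemburg norm -/
  continuous_norm : ∀ t₀ ∈ Ioc 0 T,
    Tendsto (fun t => luxemburgNorm (expYoung p) (fun x => u t x - u t₀ x))
      (𝓝[Ioc 0 T] t₀) (𝓝 0)
  /-- `u ∈ L^∞_loc(0,T; L^∞(ℝ^d))` -/
  locally_bounded : ∀ a b : ℝ, 0 < a → a ≤ b → b < T →
    ∃ M : ℝ≥0, ∀ᵐ t ∂(volume.restrict (Icc a b)), eLpNorm (u t) ∞ volume ≤ M
  /-- `u ∈ C^{1,2}((0,T) × ℝ^d)` -/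
  isC12 : IsC12 T u
  /-- the equation holds pointwise in `(0,T) × ℝ^d` -/
  equation : ∀ t ∈ Ioo 0 T, ∀ x,
    deriv (fun s => u s x) t + (-(Laplacian.laplacian (u t) x) + ‖x‖ ^ 2 * u t x) = f (u t x)
  /-- the initial condition, in the weak-star sense -/
  initial : TendstoWeakStar p u u₀

/-- The function `α (-log |x|)^{1/p}` for `|x| < 1`, and `0` for `|x| ≥ 1`. (The value at the
single point `x = 0`, where the formula is infinite, is irrelevant; here it is `0`.) -/
def logProfile (d : ℕ) (p α : ℝ) (x : EuclideanSpace ℝ (Fin d)) : ℝ :=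
  if ‖x‖ < 1 then α * (-Real.log ‖x‖) ^ (1 / p) else 0

end

/-! The proof is Kaplan's eigenfunction method on a ball of small radius `ρ = exp (-s)`. The weight
is `(1 - |x|²/ρ²)₊³`, on which `Δ - |x|²` is bounded below by `-K/ρ²` times the weight
(`neg_mul_paraboloid_le`).

If `f η ≥ a (η² - θ²)`, then the weighted mean `z` of a nonnegative solution satisfies `z' ≥ a (z² -
θ²) - (K/ρ²) z`. Once `a` dominates `K/ρ²` and `1/T`, this is a Riccati inequality above the level
`2θ`, so a mean that starts above `2θ` blows up before `T` (`false_of_paraboloid_mean`).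

The logarithmic profile supplies this start. On the ball it is at least `α s^(1/p) = 4θ`. At heights
above `θ` the growth of `f` gives `a = c exp (λ θ^p / 2) = c ρ^(-β)` with `β = (λ/2) (α/4)^p`. For
large `α` one has `β > 2`, so a small `ρ` makes the reaction beat the diffusion rate `ρ⁻²` for any
prescribed `T`. Weak-star convergence carries the initial mean to small times, since the weight lies
in the predual. -/

/-! ### Blow-up for a Riccati inequality -/

/-- A function with `y' ≥ a y²` above the level `Y > 0`, and above that level near time `0`,
blows up before time `T` if `1 / (a Y) < T`. -/
theorem false_of_riccati {y y' : ℝ → ℝ} {T a Y : ℝ} (ha : 0 < a) (hY : 0 < Y)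
    (hT : 1 / (a * Y) < T) (hy : ∀ t ∈ Ioo 0 T, HasDerivAt y (y' t) t)
    (hle : ∀ t ∈ Ioo 0 T, Y ≤ y t → a * y t ^ 2 ≤ y' t)
    (h0 : ∀ᶠ t in 𝓝[>] 0, Y ≤ y t) : False := by
  have hpos : 0 < T - 1 / (a * Y) := by linarith
  obtain ⟨ε, hεY, hε⟩ := (h0.and (Ioo_mem_nhdsGT hpos)).exists
  obtain ⟨b, hb1, hb2⟩ : ∃ b, ε + 1 / (a * Y) < b ∧ b < T :=
    exists_between (by linarith [hε.2])
  have haY : 0 < 1 / (a * Y) := by positivity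
  have hsub : ∀ t ∈ Icc ε b, t ∈ Ioo 0 T := fun t ht =>
    ⟨hε.1.trans_le ht.1, ht.2.trans_lt hb2⟩
  have hsub' : ∀ t ∈ Ico ε b, t ∈ Ioo 0 T := fun t ht => hsub t ⟨ht.1, ht.2.le⟩
  -- The level `Y` is a barrier: wherever `y = Y`, the derivative is at least `a Y² > 0`.
  have hYy : ∀ t ∈ Icc ε b, Y ≤ y t := by
    intro t ht
    have := image_le_of_deriv_right_lt_deriv_boundary (f := fun t => -y t) (f' := fun t => -y' t)
      (B := fun _ => -Y) (B' := fun _ => 0) (a := ε) (b := b)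
      (fun t ht => (hy t (hsub t ht)).continuousAt.continuousWithinAt.neg)
      (fun t ht => (hy t (hsub' t ht)).hasDerivWithinAt.neg) (by simpa using hεY)
      (fun x => hasDerivAt_const x _) (fun t ht h => by
        have h1 : y t = Y := by simpa using h
        have h2 := hle t (hsub' t ht) h1.ge
        have : 0 < a * y t ^ 2 := by rw [h1]; positivity
        simp only [Left.neg_neg_iff]; linarith) ht
    simpa using this
  have hyp : ∀ t ∈ Icc ε b, 0 < y t := fun t ht => hY.trans_le (hYy t ht)
  have hbε : ε ≤ b := by linarith
  -- `1/y` decreases at rate at least `a` from a value at most `1/Y`, so it would be negative at `b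
  -- > ε + 1/(aY)`.
  have key := image_le_of_deriv_right_le_deriv_boundary (f := fun t => (y t)⁻¹)
    (f' := fun t => -y' t / y t ^ 2) (B := fun t => Y⁻¹ - a * (t - ε)) (B' := fun _ => -a)
    (a := ε) (b := b)
    (fun t ht => ((hy t (hsub t ht)).inv (hyp t ht).ne').continuousAt.continuousWithinAt)
    (fun t ht => ((hy t (hsub' t ht)).inv (hyp t ⟨ht.1, ht.2.le⟩).ne').hasDerivWithinAt)
    (by simpa using inv_anti₀ hY hεY) (by fun_prop)
    (fun t ht => by
      have := (((hasDerivAt_id t).sub_const ε).const_mul a).const_sub Y⁻¹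
      simpa using this.hasDerivWithinAt)
    (fun t ht => by
      have ht' : t ∈ Icc ε b := ⟨ht.1, ht.2.le⟩
      have h2 := hle t (hsub t ht') (hYy t ht')
      have := hyp t ht'
      rw [div_le_iff₀ (by positivity)]
      linarith) (right_mem_Icc.2 hbε)
  have h1 : 0 < (y b)⁻¹ := inv_pos.2 (hyp b (right_mem_Icc.2 hbε))
  have h2 : Y⁻¹ < a * (b - ε) := by
    have h3 : a * (1 / (a * Y)) < a * (b - ε) := mul_lt_mul_of_pos_left (by linarith) ha
    have h4 : a * (1 / (a * Y)) = Y⁻¹ := by field_simp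
    linarith
  linarith

/-! ### Testing the equation against compactly supported functions -/

/-- Differentiation under the integral sign against a compactly supported test function. -/
theorem IsC12.hasDerivAt_integral_mul {d : ℕ} {T : ℝ} {u : ℝ → EuclideanSpace ℝ (Fin d) → ℝ}
    (hu : IsC12 T u) {φ : EuclideanSpace ℝ (Fin d) → ℝ} (hφ : Continuous φ)
    (hφc : HasCompactSupport φ) {t : ℝ} (ht : t ∈ Ioo 0 T) :
    Integrable (fun x => deriv (fun s => u s x) t * φ x) ∧
    HasDerivAt (fun s => ∫ x, u s x * φ x) (∫ x, deriv (fun s => u s x) t * φ x) t := by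
  obtain ⟨a, b, hab, hnhds, hsub⟩ : ∃ a b, t ∈ Icc a b ∧ Icc a b ∈ 𝓝 t ∧ Icc a b ⊆ Ioo 0 T := by
    refine ⟨t / 2, (t + T) / 2, ⟨by linarith [ht.1], by linarith [ht.2]⟩,
      Icc_mem_nhds (by linarith [ht.1]) (by linarith [ht.2]), fun s hs => ⟨?_, ?_⟩⟩
    · linarith [hs.1, ht.1]
    · linarith [hs.2, ht.2]
  have hcont : ∀ s ∈ Ioo 0 T, Continuous (u s) := fun s hs => (hu.contDiff_space s hs).continuous
  have hder : ∀ s ∈ Ioo 0 T, Continuous (fun x => deriv (fun r => u r x) s) := fun s hs =>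
    continuousOn_univ.1 (hu.continuousOn_time.comp
      (f := fun x : EuclideanSpace ℝ (Fin d) => (s, x)) (by fun_prop) (fun x _ => ⟨hs, mem_univ x⟩))
  obtain ⟨C, hC⟩ := (isCompact_Icc.prod hφc.isCompact).exists_bound_of_continuousOn
    (hu.continuousOn_time.mono (prod_mono hsub (subset_univ (tsupport φ))))
  refine hasDerivAt_integral_of_dominated_loc_of_deriv_le
    (F := fun s x => u s x * φ x) (F' := fun s x => deriv (fun r => u r x) s * φ x)
    (bound := fun x => C * ‖φ x‖) hnhds ?_ ?_ ?_ ?_ ?_ ?_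
  · filter_upwards [Ioo_mem_nhds ht.1 ht.2] with s hs
    exact ((hcont s hs).mul hφ).aestronglyMeasurable
  · exact ((hcont t ht).mul hφ).integrable_of_hasCompactSupport hφc.mul_left
  · exact ((hder t ht).mul hφ).aestronglyMeasurable
  · refine .of_forall fun x s hs => ?_
    rw [norm_mul]
    by_cases hx : x ∈ tsupport φ
    · exact mul_le_mul_of_nonneg_right (hC (s, x) ⟨hs, hx⟩) (norm_nonneg _)
    · simp [image_eq_zero_of_notMem_tsupport hx]
  · exact ((hφ.integrable_of_hasCompactSupport hφc).norm).const_mul C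
  · exact .of_forall fun x s hs =>
      ((hu.differentiableAt_time s (hsub hs) x).hasDerivAt).mul_const (φ x)

theorem laplacian_eq_sum_lineDeriv {d : ℕ} (w : EuclideanSpace ℝ (Fin d) → ℝ)
    (x : EuclideanSpace ℝ (Fin d)) :
    Laplacian.laplacian w x = ∑ i, fderiv ℝ (fderiv ℝ w) x (EuclideanSpace.single i 1)
      (EuclideanSpace.single i 1) := by
  rw [InnerProductSpace.laplacian_eq_iteratedFDeriv_orthonormalBasis w
    (EuclideanSpace.basisFun (Fin d) ℝ)]
  simp [iteratedFDeriv_two_apply]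

/-- Green's identity against a compactly supported function whose pure second partial derivatives
exist and are continuous. -/
theorem integral_laplacian_mul {d : ℕ} {w φ : EuclideanSpace ℝ (Fin d) → ℝ}
    {φ₁ φ₂ : Fin d → EuclideanSpace ℝ (Fin d) → ℝ} (hw : ContDiff ℝ 2 w)
    (hφ : Continuous φ) (hφc : HasCompactSupport φ)
    (hφ₁ : ∀ i, Continuous (φ₁ i)) (hφ₁c : ∀ i, HasCompactSupport (φ₁ i))
    (hφ₂ : ∀ i, Continuous (φ₂ i)) (hφ₂c : ∀ i, HasCompactSupport (φ₂ i))
    (h₁ : ∀ i x, HasLineDerivAt ℝ φ (φ₁ i x) x (EuclideanSpace.single i 1))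
    (h₂ : ∀ i x, HasLineDerivAt ℝ (φ₁ i) (φ₂ i x) x (EuclideanSpace.single i 1)) :
    ∫ x, Laplacian.laplacian w x * φ x = ∫ x, w x * ∑ i, φ₂ i x := by
  have hw1 : ContDiff ℝ 1 (fderiv ℝ w) := hw.fderiv_right (by norm_num)
  have hc0 : Continuous w := hw.continuous
  have hc1 : Continuous (fderiv ℝ w) := hw1.continuous
  have hc2 : Continuous (fderiv ℝ (fderiv ℝ w)) := hw1.continuous_fderiv (by norm_num)
  have int : ∀ {g ψ : EuclideanSpace ℝ (Fin d) → ℝ}, Continuous g → Continuous ψ →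
      HasCompactSupport ψ → Integrable (fun x => g x * ψ x) := fun hg hψ hψc =>
    (hg.mul hψ).integrable_of_hasCompactSupport hψc.mul_left
  have key : ∀ i, ∫ x, fderiv ℝ (fderiv ℝ w) x (EuclideanSpace.single i 1)
      (EuclideanSpace.single i 1) * φ x = ∫ x, w x * φ₂ i x := by
    intro i
    set e : EuclideanSpace ℝ (Fin d) := EuclideanSpace.single i 1
    have hce : Continuous (fun x => fderiv ℝ w x e) := hc1.clm_apply continuous_const
    have hcee : Continuous (fun x => fderiv ℝ (fderiv ℝ w) x e e) :=
      (hc2.clm_apply continuous_const).clm_apply continuous_const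
    have hlw : ∀ x, HasLineDerivAt ℝ w (fderiv ℝ w x e) x e := fun x =>
      ((hw.differentiable (by norm_num)) x).hasFDerivAt.hasLineDerivAt e
    have hlw' : ∀ x, HasLineDerivAt ℝ (fun x => fderiv ℝ w x e)
        (fderiv ℝ (fderiv ℝ w) x e e) x e := fun x =>
      ((ContinuousLinearMap.apply ℝ ℝ e).hasFDerivAt.comp x
        ((hw1.differentiable (by norm_num)) x).hasFDerivAt).hasLineDerivAt e
    have e1 := integral_bilinear_hasLineDerivAt_right_eq_neg_left_of_integrable (μ := volume)
      (B := ContinuousLinearMap.mul ℝ ℝ) (int hcee hφ hφc) (int hce (hφ₁ i) (hφ₁c i))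
      (int hce hφ hφc) (fun x _ => hlw' x) (fun x _ => h₁ i x)
    have e2 := integral_bilinear_hasLineDerivAt_right_eq_neg_left_of_integrable (μ := volume)
      (B := ContinuousLinearMap.mul ℝ ℝ) (int hce (hφ₁ i) (hφ₁c i)) (int hc0 (hφ₂ i) (hφ₂c i))
      (int hc0 (hφ₁ i) (hφ₁c i)) (fun x _ => hlw x) (fun x _ => h₂ i x)
    simp only [ContinuousLinearMap.mul_apply'] at e1 e2
    linarith
  simp only [laplacian_eq_sum_lineDeriv, Finset.sum_mul, Finset.mul_sum]
  rw [integral_finsetSum, integral_finsetSum]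
  · exact Finset.sum_congr rfl fun i _ => key i
  · exact fun i _ => int hc0 (hφ₂ i) (hφ₂c i)
  · exact fun i _ => int ((hc2.clm_apply continuous_const).clm_apply continuous_const) hφ hφc

/-! ### The truncated paraboloid as a weight -/

/-- At the corner the function is `O(s^(n+2)) = o(s)`, so an exponent of at least 2 removes the
kink. The cube can thus be differentiated twice, with continuous results. -/
theorem hasDerivAt_max_zero_pow (n : ℕ) (t : ℝ) :
    HasDerivAt (fun s : ℝ => max s 0 ^ (n + 2)) ((n + 2) * max t 0 ^ (n + 1)) t := by
  rcases lt_trichotomy t 0 with ht | rfl | ht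
  · have h : (fun s : ℝ => max s 0 ^ (n + 2)) =ᶠ[𝓝 t] fun _ => 0 := by
      filter_upwards [Iio_mem_nhds ht] with s hs
      simp [max_eq_right (le_of_lt (show s < 0 from hs))]
    simpa [max_eq_right ht.le] using (hasDerivAt_const t (0 : ℝ)).congr_of_eventuallyEq h
  · have h : HasDerivAt (fun s : ℝ => max s 0 ^ (n + 2)) 0 0 := by
      have hO : (fun s : ℝ => max s 0 ^ (n + 2)) =O[𝓝 0] fun s => s ^ (n + 2) :=
        Asymptotics.isBigO_of_le _ fun s => by
          rw [norm_pow, norm_pow]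
          gcongr
          rw [Real.norm_eq_abs, Real.norm_eq_abs, abs_of_nonneg (le_max_right _ _)]
          exact max_le (le_abs_self s) (abs_nonneg s)
      rw [hasDerivAt_iff_isLittleO]
      simpa using hO.trans_isLittleO (Asymptotics.isLittleO_pow_id (𝕜 := ℝ) (by omega))
    simpa using h
  · have h : (fun s : ℝ => max s 0 ^ (n + 2)) =ᶠ[𝓝 t] fun s => s ^ (n + 2) := by
      filter_upwards [Ioi_mem_nhds ht] with s hs
      simp [max_eq_left (le_of_lt (show 0 < s from hs))]
    simpa [max_eq_left ht.le] using (hasDerivAt_pow (n + 2) t).congr_of_eventuallyEq h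

/-- The truncated paraboloid power `(1 - |x|²/ρ²)₊ⁿ`. -/
noncomputable def paraboloid {d : ℕ} (ρ : ℝ) (n : ℕ) (x : EuclideanSpace ℝ (Fin d)) : ℝ :=
  max (1 - ‖x‖ ^ 2 / ρ ^ 2) 0 ^ n

theorem paraboloid_nonneg {d : ℕ} (ρ : ℝ) (n : ℕ) (x : EuclideanSpace ℝ (Fin d)) :
    0 ≤ paraboloid ρ n x :=
  pow_nonneg (le_max_right _ _) n

theorem paraboloid_le_one {d : ℕ} (ρ : ℝ) (n : ℕ) (x : EuclideanSpace ℝ (Fin d)) :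
    paraboloid ρ n x ≤ 1 :=
  pow_le_one₀ (le_max_right _ _) (max_le (by have : 0 ≤ ‖x‖ ^ 2 / ρ ^ 2 := by positivity
                                             linarith) zero_le_one)

theorem paraboloid_eq_zero {d : ℕ} {ρ : ℝ} (hρ : 0 < ρ) {n : ℕ} (hn : n ≠ 0)
    {x : EuclideanSpace ℝ (Fin d)} (hx : ρ ≤ ‖x‖) : paraboloid ρ n x = 0 := by
  have h : 1 ≤ ‖x‖ ^ 2 / ρ ^ 2 := by
    rw [one_le_div (by positivity)]
    gcongr
  rw [paraboloid, max_eq_right (by linarith), zero_pow hn]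

theorem continuous_paraboloid {d : ℕ} (ρ : ℝ) (n : ℕ) :
    Continuous (paraboloid (d := d) ρ n) := by
  unfold paraboloid
  fun_prop

theorem hasCompactSupport_paraboloid {d : ℕ} {ρ : ℝ} (hρ : 0 < ρ) {n : ℕ} (hn : n ≠ 0) :
    HasCompactSupport (paraboloid (d := d) ρ n) :=
  HasCompactSupport.intro (isCompact_closedBall 0 ρ) fun x hx =>
    paraboloid_eq_zero hρ hn (by simpa using (not_le.1 (mt mem_closedBall_zero_iff.2 hx)).le)

theorem integral_paraboloid_pos {d : ℕ} {ρ : ℝ} (hρ : 0 < ρ) {n : ℕ} (hn : n ≠ 0) :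
    0 < ∫ x : EuclideanSpace ℝ (Fin d), paraboloid ρ n x :=
  (continuous_paraboloid ρ n).integral_pos_of_hasCompactSupport_nonneg_nonzero
    (hasCompactSupport_paraboloid hρ hn) (paraboloid_nonneg ρ n) (x := 0) (by simp [paraboloid])

theorem hasLineDerivAt_paraboloid {d : ℕ} (ρ : ℝ) (n : ℕ) (i : Fin d)
    (x : EuclideanSpace ℝ (Fin d)) :
    HasLineDerivAt ℝ (paraboloid ρ (n + 2))
      ((n + 2) * paraboloid ρ (n + 1) x * (-(2 * x i) / ρ ^ 2)) x
      (EuclideanSpace.single i 1) := by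
  have h1 := ((hasStrictFDerivAt_norm_sq x).hasFDerivAt.hasLineDerivAt
    (EuclideanSpace.single i (1 : ℝ)))
  have h2 : HasDerivAt (fun t : ℝ => 1 - ‖x + t • EuclideanSpace.single i (1 : ℝ)‖ ^ 2 / ρ ^ 2)
      (-(2 * x i) / ρ ^ 2) 0 := by
    have h := (HasDerivAt.div_const h1 (ρ ^ 2)).const_sub 1
    have he : (2 • innerSL ℝ x) (EuclideanSpace.single i (1 : ℝ)) = 2 * x i := by
      simp [EuclideanSpace.inner_single_right]
    rw [he, ← neg_div] at h
    exact h
  have h3 := (hasDerivAt_max_zero_pow n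
    (1 - ‖x + (0 : ℝ) • EuclideanSpace.single i (1 : ℝ)‖ ^ 2 / ρ ^ 2)).comp 0 h2
  simpa [HasLineDerivAt, paraboloid, Function.comp_def] using h3

theorem hasLineDerivAt_coord {d : ℕ} (i : Fin d) (x : EuclideanSpace ℝ (Fin d)) :
    HasLineDerivAt ℝ (fun x : EuclideanSpace ℝ (Fin d) => x i) 1 x
      (EuclideanSpace.single i 1) := by
  have := (EuclideanSpace.proj (𝕜 := ℝ) i).hasFDerivAt (x := x)
  simpa using this.hasLineDerivAt (EuclideanSpace.single i 1)

theorem hasLineDerivAt_paraboloid_partial {d : ℕ} (ρ : ℝ) (i : Fin d)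
    (x : EuclideanSpace ℝ (Fin d)) :
    HasLineDerivAt ℝ (fun x => 3 * paraboloid ρ 2 x * (-(2 * x i) / ρ ^ 2))
      (24 * paraboloid ρ 1 x * x i ^ 2 / ρ ^ 4 - 6 * paraboloid ρ 2 x / ρ ^ 2) x
      (EuclideanSpace.single i 1) := by
  have h1 := hasLineDerivAt_paraboloid ρ 0 i x
  have h2 := hasLineDerivAt_coord i x
  have h3 := HasDerivAt.mul (HasDerivAt.const_mul 3 h1)
    (((HasDerivAt.const_mul 2 h2).neg).div_const (ρ ^ 2))
  have h4 : (24 * paraboloid ρ 1 x * x i ^ 2 / ρ ^ 4 - 6 * paraboloid ρ 2 x / ρ ^ 2) =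
      3 * ((2 : ℝ) * paraboloid ρ 1 x * (-(2 * x i) / ρ ^ 2)) * (-(2 * x i) / ρ ^ 2) +
        3 * paraboloid ρ 2 x * (-(2 * 1) / ρ ^ 2) := by ring
  rw [h4]
  simpa [HasLineDerivAt, Pi.mul_def] using h3

/-- The Laplacian of `(1 - |x|²/ρ²)₊³`. -/
noncomputable def paraboloidLaplacian {d : ℕ} (ρ : ℝ) (x : EuclideanSpace ℝ (Fin d)) : ℝ :=
  ∑ i, (24 * paraboloid ρ 1 x * x i ^ 2 / ρ ^ 4 - 6 * paraboloid ρ 2 x / ρ ^ 2)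

theorem integral_laplacian_mul_paraboloid {d : ℕ} {ρ : ℝ} (hρ : 0 < ρ)
    {w : EuclideanSpace ℝ (Fin d) → ℝ} (hw : ContDiff ℝ 2 w) :
    ∫ x, Laplacian.laplacian w x * paraboloid ρ 3 x = ∫ x, w x * paraboloidLaplacian ρ x := by
  have hc : ∀ n, Continuous (paraboloid (d := d) ρ n) := continuous_paraboloid ρ
  refine integral_laplacian_mul hw (continuous_paraboloid ρ 3)
    (hasCompactSupport_paraboloid hρ (by norm_num))
    (φ₁ := fun i x => 3 * paraboloid ρ 2 x * (-(2 * x i) / ρ ^ 2)) (fun i => ?_) (fun i => ?_)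
    (fun i => ?_) (fun i => ?_) (fun i x => ?_) (fun i x => hasLineDerivAt_paraboloid_partial ρ i x)
  · have := hc 2
    fun_prop
  · exact ((hasCompactSupport_paraboloid hρ (n := 2) (by norm_num)).mul_left).mul_right
  · have := hc 1
    have := hc 2
    fun_prop
  · refine HasCompactSupport.intro (isCompact_closedBall 0 ρ) fun x hx => ?_
    have hx' : ρ ≤ ‖x‖ := by simpa using (not_le.1 (mt mem_closedBall_zero_iff.2 hx)).le
    simp [paraboloid_eq_zero hρ _ hx']
  · have := hasLineDerivAt_paraboloid ρ 1 i x
    norm_num at this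
    exact this

theorem continuous_paraboloidLaplacian {d : ℕ} (ρ : ℝ) :
    Continuous (paraboloidLaplacian (d := d) ρ) := by
  have h1 := continuous_paraboloid (d := d) ρ 1
  have h2 := continuous_paraboloid (d := d) ρ 2
  unfold paraboloidLaplacian
  fun_prop

theorem hasCompactSupport_paraboloidLaplacian {d : ℕ} {ρ : ℝ} (hρ : 0 < ρ) :
    HasCompactSupport (paraboloidLaplacian (d := d) ρ) := by
  refine HasCompactSupport.intro (isCompact_closedBall 0 ρ) fun x hx => ?_
  have hx' : ρ ≤ ‖x‖ := by simpa using (not_le.1 (mt mem_closedBall_zero_iff.2 hx)).le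
  simp [paraboloidLaplacian, paraboloid_eq_zero hρ _ hx']

/-- `(1 - |x|²/ρ²)₊³` is a subsolution of an eigenvalue problem for `-Δ + |x|²`. -/
theorem neg_mul_paraboloid_le {d : ℕ} {ρ : ℝ} (hρ : 0 < ρ) (hρ1 : ρ ≤ 1)
    (x : EuclideanSpace ℝ (Fin d)) :
    -(((24 + 6 * d) ^ 2 + 1) / ρ ^ 2) * paraboloid ρ 3 x ≤
      paraboloidLaplacian ρ x - ‖x‖ ^ 2 * paraboloid ρ 3 x := by
  have hsum : paraboloidLaplacian ρ x =
      (24 * paraboloid ρ 1 x * (‖x‖ ^ 2 / ρ ^ 2) - 6 * d * paraboloid ρ 2 x) / ρ ^ 2 := by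
    rw [paraboloidLaplacian, Finset.sum_sub_distrib, ← Finset.sum_div, ← Finset.mul_sum,
      EuclideanSpace.norm_sq_eq]
    simp only [Real.norm_eq_abs, sq_abs, Finset.sum_const, Finset.card_univ, Fintype.card_fin,
      nsmul_eq_mul]
    field_simp
  rcases le_or_gt ρ ‖x‖ with hx | hx
  · simp [hsum, paraboloid_eq_zero hρ _ hx]
  set h := 1 - ‖x‖ ^ 2 / ρ ^ 2 with hh
  have hh0 : 0 < h := by
    have : ‖x‖ ^ 2 / ρ ^ 2 < 1 := by
      rw [div_lt_one (by positivity)]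
      gcongr
    linarith
  have hp : ∀ n, paraboloid ρ n x = h ^ n := fun n => by
    rw [paraboloid, ← hh, max_eq_left hh0.le]
  have hx2 : ‖x‖ ^ 2 ≤ 1 / ρ ^ 2 := by
    rw [le_div_iff₀ (by positivity)]
    have h1 : ‖x‖ ^ 2 ≤ 1 := pow_le_one₀ (norm_nonneg x) (by linarith)
    have h2 : ρ ^ 2 ≤ 1 := pow_le_one₀ hρ.le hρ1
    nlinarith [sq_nonneg ‖x‖, sq_nonneg ρ]
  -- After division by `h` this is `24 - r + r² ≥ 0` with `r = (24 + 6d) h`. Near the sphere the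
  -- positive term `24 h` dominates.
  have hmain : -(24 + 6 * (d : ℝ)) ^ 2 * h ^ 3 ≤ 24 * h * (1 - h) - 6 * d * h ^ 2 := by
    have : 0 ≤ 24 - (24 + 6 * (d : ℝ)) * h + ((24 + 6 * (d : ℝ)) * h) ^ 2 := by
      nlinarith [sq_nonneg ((24 + 6 * (d : ℝ)) * h - 1 / 2)]
    nlinarith [mul_nonneg hh0.le this]
  have hxe : ‖x‖ ^ 2 / ρ ^ 2 = 1 - h := by rw [hh]; ring
  rw [hsum, hp, hp, hp, hxe]
  have h3 : ‖x‖ ^ 2 * h ^ 3 ≤ 1 / ρ ^ 2 * h ^ 3 := by gcongr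
  have h4 : (-(24 + 6 * (d : ℝ)) ^ 2 * h ^ 3) / ρ ^ 2 ≤
      (24 * h * (1 - h) - 6 * d * h ^ 2) / ρ ^ 2 := by gcongr
  have h5 : -(((24 + 6 * (d : ℝ)) ^ 2 + 1) / ρ ^ 2) * h ^ 3 =
      (-(24 + 6 * (d : ℝ)) ^ 2 * h ^ 3) / ρ ^ 2 - 1 / ρ ^ 2 * h ^ 3 := by ring
  rw [h5, pow_one]
  linarith

/-! ### The weight belongs to the predual -/

/-- For `r ≥ 0`, `s r ≤ r ≤ 1 + r^p ≤ exp (r^p)`. Finiteness on `[0, 1]` is all that a weight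
bounded by 1 with compact support requires. -/
theorem youngConj_expYoung_le_one {p s : ℝ} (hp : 1 ≤ p) (hs : s ≤ 1) :
    youngConj (expYoung p) s ≤ 1 := by
  refine iSup_le fun r => tsub_le_iff_right.2 ?_
  rw [expYoung, ← ENNReal.ofReal_one, ← ENNReal.ofReal_add zero_le_one]
  · refine ENNReal.ofReal_le_ofReal ?_
    have h1 : s * r ≤ r := by nlinarith [r.2, r.coe_nonneg]
    have h2 : (r : ℝ) ≤ 1 + (r : ℝ) ^ p := by
      rcases le_total (r : ℝ) 1 with h | h
      · linarith [Real.rpow_nonneg r.coe_nonneg p]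
      · linarith [Real.self_le_rpow_of_one_le h hp]
    linarith [Real.add_one_le_exp ((r : ℝ) ^ p)]
  · have := Real.rpow_nonneg r.coe_nonneg p
    linarith [Real.add_one_le_exp ((r : ℝ) ^ p)]

theorem youngConj_zero (Φ : ℝ → ℝ≥0∞) : youngConj Φ 0 = 0 := by
  simp [youngConj]

theorem memOrlicz_youngConj_paraboloid {d : ℕ} {p ρ : ℝ} (hp : 1 ≤ p) (hρ : 0 < ρ) {n : ℕ}
    (hn : n ≠ 0) : MemOrlicz (youngConj (expYoung p)) (paraboloid (d := d) ρ n) := by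
  refine ⟨(continuous_paraboloid ρ n).locallyIntegrable, 1, one_pos, ?_⟩
  calc ∫⁻ x, youngConj (expYoung p) (|paraboloid ρ n x| / 1)
      ≤ ∫⁻ x, (Metric.closedBall (0 : EuclideanSpace ℝ (Fin d)) ρ).indicator (fun _ => 1) x := by
        refine lintegral_mono fun x => ?_
        rw [div_one, abs_of_nonneg (paraboloid_nonneg ρ n x)]
        by_cases hx : x ∈ Metric.closedBall (0 : EuclideanSpace ℝ (Fin d)) ρ
        · rw [indicator_of_mem hx]
          exact youngConj_expYoung_le_one hp (paraboloid_le_one ρ n x)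
        · rw [indicator_of_notMem hx, paraboloid_eq_zero hρ hn
            (not_le.1 (mt mem_closedBall_zero_iff.2 hx)).le, youngConj_zero]
    _ < ∞ := by
        rw [lintegral_indicator_const measurableSet_closedBall, one_mul]
        exact measure_closedBall_lt_top

/-! ### The logarithmic profile -/

theorem logProfile_nonneg {d : ℕ} {p α : ℝ} (hα : 0 ≤ α) (x : EuclideanSpace ℝ (Fin d)) :
    0 ≤ logProfile d p α x := by
  unfold logProfile
  split_ifs with h
  · exact mul_nonneg hα (Real.rpow_nonneg
      (neg_nonneg.2 (Real.log_nonpos (norm_nonneg x) h.le)) _)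
  · exact le_rfl

theorem measurable_logProfile (d : ℕ) (p α : ℝ) : Measurable (logProfile d p α) := by
  unfold logProfile
  exact Measurable.ite (measurableSet_lt measurable_norm measurable_const) (by fun_prop)
    measurable_const

/-- In polar coordinates the extra factor `y^(d-1)` is at most 1. This one function dominates both
the profile and its exponential integrand. -/
theorem integrableOn_norm_rpow_neg_half {d : ℕ} (hd : 1 ≤ d) :
    IntegrableOn (fun x : EuclideanSpace ℝ (Fin d) => ‖x‖ ^ (-(1 / 2) : ℝ))
      (Metric.ball 0 1) := by
  have : Nonempty (Fin d) := ⟨⟨0, hd⟩⟩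
  have h1 : IntegrableOn (fun y : ℝ => y ^ (-(1 / 2) : ℝ)) (Ioo 0 1) :=
    (intervalIntegral.integrableOn_Ioo_rpow_iff one_pos).2 (by norm_num)
  refine (integrableOn_fun_norm_addHaar volume (f := fun y : ℝ => y ^ (-(1 / 2) : ℝ))).2 ?_
  refine Integrable.mono' h1 (by fun_prop) ?_
  filter_upwards [ae_restrict_mem measurableSet_Ioo] with y hy
  have h2 : 0 ≤ y ^ (-(1 / 2) : ℝ) := Real.rpow_nonneg hy.1.le _
  rw [smul_eq_mul, norm_mul, Real.norm_of_nonneg h2, norm_pow, Real.norm_of_nonneg hy.1.le]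
  exact mul_le_of_le_one_left h2 (pow_le_one₀ hy.1.le hy.2.le)

theorem integrable_indicator_norm_rpow_neg_half {d : ℕ} (hd : 1 ≤ d) :
    Integrable ((Metric.ball 0 1).indicator
      fun x : EuclideanSpace ℝ (Fin d) => ‖x‖ ^ (-(1 / 2) : ℝ)) :=
  (integrable_indicator_iff measurableSet_ball).2 (integrableOn_norm_rpow_neg_half hd)

/-- With `s = -log |x|`, `s^(1/p) ≤ 1 + s ≤ 2 exp (s/2)` and `exp (s/2) = |x|^(-1/2)`. -/
theorem logProfile_le {d : ℕ} {p α : ℝ} (hp : 1 ≤ p) (hα : 0 ≤ α)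
    (x : EuclideanSpace ℝ (Fin d)) (hx : x ≠ 0) :
    logProfile d p α x ≤ 2 * α * (Metric.ball 0 1).indicator (fun x => ‖x‖ ^ (-(1 / 2) : ℝ)) x := by
  by_cases h : ‖x‖ < 1
  · rw [logProfile, if_pos h, indicator_of_mem (by simpa using h)]
    have hx0 : 0 < ‖x‖ := norm_pos_iff.2 hx
    set s := -Real.log ‖x‖ with hs
    have hs0 : 0 ≤ s := neg_nonneg.2 (Real.log_nonpos (norm_nonneg x) h.le)
    have h1 : s ^ (1 / p) ≤ 1 + s := by
      rcases le_total s 1 with h1 | h1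
      · linarith [Real.rpow_le_one hs0 h1 (by positivity : 0 ≤ 1 / p)]
      · have : s ^ (1 / p) ≤ s ^ (1 : ℝ) := Real.rpow_le_rpow_of_exponent_le h1
          ((div_le_one (by linarith)).2 hp)
        rw [Real.rpow_one] at this
        linarith
    have h2 : ‖x‖ ^ (-(1 / 2) : ℝ) = Real.exp (s / 2) := by
      rw [Real.rpow_def_of_pos hx0, hs]
      ring_nf
    rw [h2]
    have h3 := Real.add_one_le_exp (s / 2)
    calc α * s ^ (1 / p) ≤ α * (2 * Real.exp (s / 2)) := by
          gcongr
          linarith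
      _ = 2 * α * Real.exp (s / 2) := by ring
  · rw [logProfile, if_neg h, indicator_of_notMem (by simpa using h), mul_zero]

theorem integrable_logProfile {d : ℕ} (hd : 1 ≤ d) {p α : ℝ} (hp : 1 ≤ p) (hα : 0 ≤ α) :
    Integrable (logProfile d p α) := by
  have : Nonempty (Fin d) := ⟨⟨0, hd⟩⟩
  refine ((integrable_indicator_norm_rpow_neg_half hd).const_mul (2 * α)).mono'
    (measurable_logProfile d p α).aestronglyMeasurable ?_
  filter_upwards [compl_mem_ae_iff.2 (measure_singleton (0 : EuclideanSpace ℝ (Fin d)))] with x hx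
  rw [Real.norm_of_nonneg (logProfile_nonneg hα x)]
  exact logProfile_le hp hα x hx

theorem memExpL_logProfile {d : ℕ} (hd : 1 ≤ d) {p α : ℝ} (hp : 1 ≤ p) (hα : 0 < α) :
    MemExpL p (logProfile d p α) := by
  have : Nonempty (Fin d) := ⟨⟨0, hd⟩⟩
  have hp0 : 0 < p := by linarith
  -- With `k = α 2^(1/p)` the exponent `(u₀/k)^p` is `-log |x| / 2`, so the exponential is
  -- `|x|^(-1/2)`.
  refine ⟨(integrable_logProfile hd hp hα.le).locallyIntegrable, α * 2 ^ (1 / p), by positivity, ?_⟩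
  refine lt_of_le_of_lt (lintegral_mono_ae ?_)
    (integrable_indicator_norm_rpow_neg_half hd).lintegral_lt_top
  filter_upwards [compl_mem_ae_iff.2 (measure_singleton (0 : EuclideanSpace ℝ (Fin d)))] with x hx
  have hx0 : 0 < ‖x‖ := norm_pos_iff.2 hx
  refine ENNReal.ofReal_le_ofReal ?_
  rw [abs_of_nonneg (logProfile_nonneg hα.le x)]
  by_cases h : ‖x‖ < 1
  · rw [logProfile, if_pos h, indicator_of_mem (by simpa using h)]
    have hs0 : 0 ≤ -Real.log ‖x‖ := neg_nonneg.2 (Real.log_nonpos (norm_nonneg x) h.le)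
    rw [mul_div_mul_left _ _ hα.ne', ← Real.div_rpow hs0 zero_le_two, ← Real.rpow_mul
      (by positivity), one_div_mul_cancel hp0.ne', Real.rpow_one, Real.rpow_def_of_pos hx0]
    have : -Real.log ‖x‖ / 2 = Real.log ‖x‖ * -(1 / 2) := by ring
    rw [this]
    linarith
  · rw [logProfile, if_neg h, indicator_of_notMem (by simpa using h), zero_div,
      Real.zero_rpow hp0.ne', Real.exp_zero, sub_self]

/-- The profile is radially decreasing away from the origin, so on the ball it is at least its value
at radius `ρ`. -/
theorem mul_integral_paraboloid_le {d : ℕ} (hd : 1 ≤ d) {p α ρ : ℝ} (hp : 1 ≤ p) (hα : 0 ≤ α)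
    (hρ : 0 < ρ) (hρ1 : ρ ≤ 1) {n : ℕ} (hn : n ≠ 0) :
    α * (-Real.log ρ) ^ (1 / p) * ∫ x : EuclideanSpace ℝ (Fin d), paraboloid ρ n x ≤
      ∫ x, logProfile d p α x * paraboloid ρ n x := by
  have : Nonempty (Fin d) := ⟨⟨0, hd⟩⟩
  rw [← integral_const_mul]
  refine integral_mono_ae (((continuous_paraboloid ρ n).integrable_of_hasCompactSupport
    (hasCompactSupport_paraboloid hρ hn)).const_mul _) ?_ ?_
  · refine (integrable_logProfile hd hp hα).mul_bdd (c := 1)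
      (continuous_paraboloid ρ n).aestronglyMeasurable (.of_forall fun x => ?_)
    rw [Real.norm_of_nonneg (paraboloid_nonneg ρ n x)]
    exact paraboloid_le_one ρ n x
  · filter_upwards [compl_mem_ae_iff.2 (measure_singleton (0 : EuclideanSpace ℝ (Fin d)))] with x hx
    have hx0 : 0 < ‖x‖ := norm_pos_iff.2 hx
    rcases le_or_gt ρ ‖x‖ with h | h
    · simp [paraboloid_eq_zero hρ hn h]
    · refine mul_le_mul_of_nonneg_right ?_ (paraboloid_nonneg ρ n x)
      rw [logProfile, if_pos (h.trans_le hρ1)]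
      have h1 : 0 ≤ -Real.log ρ := neg_nonneg.2 (Real.log_nonpos hρ.le hρ1)
      have h2 := Real.log_le_log hx0 h.le
      gcongr

/-! ### Growth of `f`, blow-up of the mean and choice of parameters -/

/-- A positive lower limit of `f η exp (-λ η^p)`, `p ≥ 1`, leaves room for an extra factor `η²`
after the rate `λ` is halved. -/
theorem exists_mul_exp_mul_sq_le {f : ℝ → ℝ} {lam p : ℝ} (hlam : 0 < lam) (hp : 1 ≤ p)
    (hliminf : 0 < liminf
      (fun η : ℝ => ((f η * Real.exp (-(lam * η ^ p)) : ℝ) : EReal)) atTop) :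
    ∃ c R : ℝ, 0 < c ∧ 1 ≤ R ∧ ∀ η, R ≤ η → c * Real.exp (lam / 2 * η ^ p) * η ^ 2 ≤ f η := by
  obtain ⟨c, hc0, hc⟩ := EReal.lt_iff_exists_real_btwn.1 hliminf
  obtain ⟨R, hR⟩ := eventually_atTop.1 (eventually_lt_of_lt_liminf hc)
  have hc0' : 0 < c := by exact_mod_cast hc0
  -- The constant comes from `exp v ≥ v²/2` at `v = λ η^p / 2`, together with `η^p ≥ η`.
  refine ⟨c * (lam ^ 2 / 8), max R 1, by positivity, le_max_right _ _, fun η hη => ?_⟩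
  have h1 : c < f η * Real.exp (-(lam * η ^ p)) := by
    exact_mod_cast hR η ((le_max_left _ _).trans hη)
  have hη1 : 1 ≤ η := (le_max_right _ _).trans hη
  have h2 : η ≤ η ^ p := Real.self_le_rpow_of_one_le hη1 hp
  have h3 : c * Real.exp (lam * η ^ p) ≤ f η := by
    rw [Real.exp_neg, ← div_eq_mul_inv, lt_div_iff₀ (Real.exp_pos _)] at h1
    exact h1.le
  have h4 : lam ^ 2 / 8 * η ^ 2 ≤ Real.exp (lam / 2 * η ^ p) := by
    have h5 := Real.quadratic_le_exp_of_nonneg (x := lam / 2 * η ^ p) (by positivity)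
    have h6 : (lam / 2 * η) ^ 2 ≤ (lam / 2 * η ^ p) ^ 2 := by gcongr
    have h7 : 0 ≤ lam / 2 * η ^ p := by positivity
    nlinarith
  calc c * (lam ^ 2 / 8) * Real.exp (lam / 2 * η ^ p) * η ^ 2
      = c * (Real.exp (lam / 2 * η ^ p) * (lam ^ 2 / 8 * η ^ 2)) := by ring
    _ ≤ c * (Real.exp (lam / 2 * η ^ p) * Real.exp (lam / 2 * η ^ p)) := by gcongr
    _ = c * Real.exp (lam * η ^ p) := by rw [← Real.exp_add]; ring_nf
    _ ≤ f η := h3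

/-- Blow-up by the eigenfunction method: a nonnegative solution whose weighted mean over the ball
of radius `ρ` starts above `2θ` cannot exist up to time `T`, if `f η ≥ a (η² - θ²)` with `a` large
compared with `ρ⁻²` and `T⁻¹`. -/
theorem false_of_paraboloid_mean {d : ℕ} {f : ℝ → ℝ} {T ρ a θ m₀ : ℝ}
    {u : ℝ → EuclideanSpace ℝ (Fin d) → ℝ} (hT : 0 < T) (hρ : 0 < ρ) (hρ1 : ρ ≤ 1)
    (hθ : 1 ≤ θ) (haρ : 4 * (((24 + 6 * d) ^ 2 + 1) / ρ ^ 2) ≤ a) (haT : 1 / T < a)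
    (hf : ∀ η, 0 ≤ η → a * (η ^ 2 - θ ^ 2) ≤ f η) (hu : IsC12 T u)
    (hu0 : ∀ t ∈ Ioo 0 T, ∀ x, 0 ≤ u t x)
    (heq : ∀ t ∈ Ioo 0 T, ∀ x, deriv (fun s => u s x) t +
      (-(Laplacian.laplacian (u t) x) + ‖x‖ ^ 2 * u t x) = f (u t x))
    (hlim : Tendsto (fun t => ∫ x, u t x * paraboloid ρ 3 x) (𝓝[>] 0) (𝓝 m₀))
    (hm₀ : 2 * θ * ∫ x : EuclideanSpace ℝ (Fin d), paraboloid ρ 3 x < m₀) : False := by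
  set φ : EuclideanSpace ℝ (Fin d) → ℝ := paraboloid ρ 3 with hφ_def
  have hφ : Continuous φ := continuous_paraboloid ρ 3
  have hφc : HasCompactSupport φ := hasCompactSupport_paraboloid hρ (by norm_num)
  set m := ∫ x, φ x with hm_def
  have hm : 0 < m := integral_paraboloid_pos hρ (by norm_num)
  set K : ℝ := ((24 + 6 * d) ^ 2 + 1) / ρ ^ 2 with hK
  have hK0 : 0 < K := by positivity
  have ha : 0 < a := by linarith
  set y : ℝ → ℝ := fun t => ∫ x, u t x * φ x with hy
  set z : ℝ → ℝ := fun t => y t / m with hz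
  have hineq : ∀ t ∈ Ioo 0 T,
      m * (a * (z t ^ 2 - θ ^ 2) - K * z t) ≤ ∫ x, deriv (fun s => u s x) t * φ x := by
    intro t ht
    have hut : Continuous (u t) := (hu.contDiff_space t ht).continuous
    have hI : ∀ {g ψ : EuclideanSpace ℝ (Fin d) → ℝ}, Continuous g → Continuous ψ →
        HasCompactSupport ψ → Integrable (fun x => g x * ψ x) := fun hg hψ hψc =>
      (hg.mul hψ).integrable_of_hasCompactSupport hψc.mul_left
    have hlapc : Continuous (Laplacian.laplacian (u t)) := by
      have h1 : ContDiff ℝ 1 (fderiv ℝ (u t)) :=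
        (hu.contDiff_space t ht).fderiv_right (by norm_num)
      have h2 := h1.continuous_fderiv (by norm_num)
      rw [funext (laplacian_eq_sum_lineDeriv (u t))]
      fun_prop
    have hi1 := (hu.hasDerivAt_integral_mul hφ hφc ht).1
    have hi2 := hI hlapc hφ hφc
    have hi3 := hI hut (continuous_paraboloidLaplacian ρ) (hasCompactSupport_paraboloidLaplacian hρ)
    have hi4 := hI hut hφ hφc
    have hi5 := hφ.integrable_of_hasCompactSupport hφc (μ := volume)
    have hgreen := integral_laplacian_mul_paraboloid hρ (hu.contDiff_space t ht)
    -- The tangent line `u² ≥ 2zu - z²` at the mean replaces Jensen's inequality. The two Laplacian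
    -- terms on the right cancel after integration, by Green's identity.
    have hmono : ∫ x, ((2 * a * z t - K) * (u t x * φ x) - a * (z t ^ 2 + θ ^ 2) * φ x) ≤
        ∫ x, (deriv (fun s => u s x) t * φ x - Laplacian.laplacian (u t) x * φ x +
          u t x * paraboloidLaplacian ρ x) := by
      refine integral_mono ((hi4.const_mul _).sub (hi5.const_mul _)) ((hi1.sub hi2).add hi3)
        fun x => ?_
      have h0 := hu0 t ht x
      have h1 := heq t ht x
      have h2 := hf _ h0
      have h3 := neg_mul_paraboloid_le hρ hρ1 x
      rw [← hK, ← hφ_def] at h3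
      have hφ0 : 0 ≤ φ x := paraboloid_nonneg ρ 3 x
      have h4 : (deriv (fun s => u s x) t - Laplacian.laplacian (u t) x) * φ x =
          (f (u t x) - ‖x‖ ^ 2 * u t x) * φ x := by rw [← h1]; ring
      have h5 := mul_le_mul_of_nonneg_left h3 h0
      have h6 : a * (2 * z t * u t x - z t ^ 2 - θ ^ 2) ≤ f (u t x) :=
        le_trans (mul_le_mul_of_nonneg_left (by nlinarith [sq_nonneg (u t x - z t)]) ha.le) h2
      have h7 := mul_le_mul_of_nonneg_right h6 hφ0
      simp only
      linarith
    have hadd := integral_add (hi1.sub hi2) hi3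
    simp only [Pi.sub_apply] at hadd
    rw [hadd, integral_sub hi1 hi2, hgreen,
      integral_sub (hi4.const_mul _) (hi5.const_mul _), integral_const_mul, integral_const_mul,
      sub_add_cancel] at hmono
    have hyz : ∫ x, u t x * φ x = m * z t := by
      simp only [hz, hy]
      field_simp
    rw [hyz, ← hm_def] at hmono
    refine le_trans (le_of_eq ?_) hmono
    ring
  refine false_of_riccati (y := z) (y' := fun t => (∫ x, deriv (fun s => u s x) t * φ x) / m)
    (T := T) (a := a / 2) (Y := 2 * θ) (by positivity) (by positivity) ?_
    (fun t ht => (hu.hasDerivAt_integral_mul hφ hφc ht).2.div_const m) (fun t ht hzt => ?_) ?_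
  -- The blow-up time is at most `1/(aθ) ≤ 1/a < T`.
  · have h1 : a / 2 * (2 * θ) = a * θ := by ring
    rw [h1, div_lt_iff₀ (by positivity)]
    rw [div_lt_iff₀ hT] at haT
    nlinarith [mul_le_mul_of_nonneg_left hθ (mul_pos ha hT).le]
  · rw [le_div_iff₀ hm]
    refine le_trans ?_ (hineq t ht)
    rw [mul_comm _ m]
    refine mul_le_mul_of_nonneg_left ?_ hm.le
    -- Above `2θ ≥ 1`, each of the losses `a θ²` and `K z` is at most `a z²/4`, which leaves `a
    -- z²/2`.
    have h1 : 4 * θ ^ 2 ≤ z t ^ 2 := by nlinarith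
    have h2 : 4 * K * z t ≤ a * z t := mul_le_mul_of_nonneg_right haρ (by linarith)
    have h3 : a * z t ≤ a * z t ^ 2 := mul_le_mul_of_nonneg_left (by nlinarith) ha.le
    have h4 := mul_le_mul_of_nonneg_left h1 ha.le
    linarith
  · filter_upwards [hlim.eventually_const_lt hm₀] with t ht
    rw [hz]
    exact (le_div_iff₀ hm).2 ht.le

theorem theorem1p3 (d : ℕ) (hd : 1 ≤ d) (f : ℝ → ℝ) (hf : Continuous f)
    (hf_nonneg : ∀ η : ℝ, 0 ≤ η → 0 ≤ f η)
    (lam p : ℝ) (hlam : 0 < lam) (hp : 1 < p)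
    (hliminf : 0 < liminf
      (fun η : ℝ => ((f η * Real.exp (-(lam * η ^ p)) : ℝ) : EReal)) atTop) :
    ∃ α₀ : ℝ, 0 < α₀ ∧ ∀ α : ℝ, α₀ < α →
      (∀ x, 0 ≤ logProfile d p α x) ∧ MemExpL p (logProfile d p α) ∧
      ∀ T : ℝ, 0 < T →
        ¬ ∃ u : ℝ → EuclideanSpace ℝ (Fin d) → ℝ,
          IsExpLClassicalSolution f p T (logProfile d p α) u ∧
          ∀ t ∈ Ioo 0 T, ∀ x, 0 ≤ u t x := by
  have hp0 : 0 < p := by linarith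
  have hα₀ : 0 < 4 * (4 / lam) ^ (1 / p) := by positivity
  refine ⟨4 * (4 / lam) ^ (1 / p), hα₀, fun α hα => ?_⟩
  have hα0 : 0 < α := hα₀.trans hα
  refine ⟨logProfile_nonneg hα0.le, memExpL_logProfile hd hp.le hα0, ?_⟩
  rintro T hT ⟨u, hu, hu0⟩
  obtain ⟨c, R, hc, hR, hcR⟩ := exists_mul_exp_mul_sq_le hlam hp.le hliminf
  set β := lam / 2 * (α / 4) ^ p with hβ
  -- This is exactly the condition `α > α₀`.
  have hβ2 : 2 < β := by
    have h1 : ((4 / lam) ^ (1 / p)) ^ p < (α / 4) ^ p :=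
      Real.rpow_lt_rpow (by positivity) (by linarith) hp0
    rw [← Real.rpow_mul (by positivity), one_div_mul_cancel hp0.ne', Real.rpow_one,
      div_lt_iff₀ hlam] at h1
    rw [hβ]
    linarith
  set K : ℝ := (24 + 6 * d) ^ 2 + 1 with hK
  have hlarge : ∀ {b : ℝ}, 0 < b → Tendsto (fun s => c * Real.exp (b * s)) atTop atTop :=
    fun hb => (Real.tendsto_exp_atTop.comp (tendsto_id.const_mul_atTop hb)).const_mul_atTop hc
  have hroot : Tendsto (fun s : ℝ => α / 4 * s ^ (1 / p)) atTop atTop :=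
    (tendsto_rpow_atTop (by positivity)).const_mul_atTop (by positivity)
  -- Here `s = -log ρ`. The requirements are `θ ≥ R`, `c ρ^(2-β) ≥ 4K` and `c ρ^(-β) > 1/T`.
  obtain ⟨s, hs0, hsR, hsK, hsT⟩ := ((eventually_ge_atTop 0).and
    ((hroot.eventually_ge_atTop R).and (((hlarge (sub_pos.2 hβ2)).eventually_ge_atTop (4 * K)).and
      ((hlarge (by linarith : 0 < β)).eventually_gt_atTop (1 / T))))).exists
  set θ := α / 4 * s ^ (1 / p) with hθ
  have hθ1 : 1 ≤ θ := hR.trans hsR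
  have hθp : lam / 2 * θ ^ p = β * s := by
    rw [hθ, Real.mul_rpow (by positivity) (by positivity), ← Real.rpow_mul hs0,
      one_div_mul_cancel hp0.ne', Real.rpow_one, hβ]
    ring
  have hρ1 : Real.exp (-s) ≤ 1 := Real.exp_le_one_iff.2 (by linarith)
  refine false_of_paraboloid_mean (a := c * Real.exp (β * s)) (θ := θ) hT (Real.exp_pos (-s)) hρ1
    hθ1 ?_ hsT (fun η hη => ?_) hu.isC12 hu0 hu.equation
    (hu.initial _ (memOrlicz_youngConj_paraboloid hp.le (Real.exp_pos _) (by norm_num))) ?_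
  · have h1 : 4 * (K / Real.exp (-s) ^ 2) = 4 * K * Real.exp (2 * s) := by
      rw [← Real.exp_nat_mul, div_eq_mul_inv, ← Real.exp_neg]
      push_cast
      ring_nf
    have h2 : c * Real.exp (β * s) = c * Real.exp ((β - 2) * s) * Real.exp (2 * s) := by
      rw [mul_assoc c (Real.exp ((β - 2) * s)), ← Real.exp_add]
      ring_nf
    rw [h1, h2]
    gcongr
  -- Below `θ` the quadratic bound is nonpositive and `f ≥ 0` suffices; the exponential growth is
  -- needed only above `θ`.
  · rcases le_or_gt η θ with h | h
    · have h1 : η ^ 2 - θ ^ 2 ≤ 0 := by nlinarith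
      exact (mul_nonpos_of_nonneg_of_nonpos (by positivity) h1).trans (hf_nonneg η hη)
    · refine le_trans ?_ (hcR η (hsR.trans h.le))
      have h1 : β * s ≤ lam / 2 * η ^ p := by
        rw [← hθp]
        gcongr
      calc c * Real.exp (β * s) * (η ^ 2 - θ ^ 2) ≤ c * Real.exp (β * s) * η ^ 2 := by
            gcongr
            linarith [sq_nonneg θ]
        _ ≤ c * Real.exp (lam / 2 * η ^ p) * η ^ 2 := by gcongr
  · refine lt_of_lt_of_le ?_ (mul_integral_paraboloid_le hd hp.le hα0.le (Real.exp_pos _) hρ1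
      (by norm_num))
    refine mul_lt_mul_of_pos_right ?_ (integral_paraboloid_pos (Real.exp_pos _) (by norm_num))
    rw [Real.log_exp, neg_neg]
    have h1 : α * s ^ (1 / p) = 4 * θ := by rw [hθ]; ring
    linarith
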